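/- For ordinals $\alpha,\beta$ let $\alpha\oplus\beta$ be the Hessenberg natural sum, obtained by writing $\alpha,\beta$ in Cantor normal form to base $\omega$ and adding the coefficients of equal powers of $\omega$. For a sequence $(\alpha_\gamma)_{\gamma<\zeta}$ of ordinals, define $\bigoplus_{\gamma<\delta}\alpha_\gamma$ for $\delta\le\zeta$ recursively by $\bigoplus_{\gamma<0}\alpha_\gamma=0$, $\bigoplus_{\gamma<\delta+1}\alpha_\gamma=\bigl(\bigoplus_{\gamma<\delta}\alpha_\gamma\bigr)\oplus\alpha_\delta$, and $\bigoplus_{\gamma<\delta}\alpha_\gamma=\sup_{\delta'<\delta}\bigoplus_{\gamma<\delta'}\alpha_\gamma$ for $\delta$ limit. An ordinal $\beta$ is a *mixed sum* of $(\alpha_\gamma)_{\gamma<\zeta}$, *realized by* $(A_\gamma)_{\gamma<\zeta}$, if the $A_\gamma$ are pairwise disjoint subsets of $\beta=\{\xi\mid\xi<\beta\}$ with $\bigcup_{\gamma<\zeta}A_\gamma=\beta$ and each $A_\gamma$ has order type $\alpha_\gamma$ in the induced order. A piece $A_\varepsilon$ is *convex* (in the realization) if $\{\xi<\beta\mid a<\xi<a'\}\subseteq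 A_\varepsilon$ for all $a<a'$ in $A_\varepsilon$. Consider the following conditions on a realization $(A_\gamma)_{\gamma<\zeta}$: 1. for every $\varepsilon<\zeta$, the set $\Gamma_\varepsilon=\{\gamma<\zeta\mid\gamma>\varepsilon\text{ and }b<a\text{ for some }b\in A_\gamma\text{ and }a\in A_\varepsilon\}$ is finite; 2. all but finitely many of the $A_\varepsilon$ are convex in the realization; 3. for every $\varepsilon<\zeta$ and $a\in A_\varepsilon$, the set $\{\gamma<\zeta\mid\gamma>\varepsilon\text{ and }b<a\text{ for some }b\in A_\gamma\}$ is finite. **Corollary.** Let $\zeta$ be an ordinal and $(\alpha_\gamma)_{\gamma<\zeta}$ a sequence of ordinals. Then $\bigoplus_{\gamma<\zeta}\alpha_\gamma$ is a mixed sum of $(\alpha_\gamma)_{\gamma<\zeta}$, and it has a realization satisfying both (1) and (2). Condition (1) implies condition (3) for every realization of a mixed sum of $(\alpha_\gamma)_{\gamma<\zeta}$. Moreover, $\bigoplus_{\gamma<\zeta}\alpha_\gamma$ is the largest mixed sum of $(\alpha_\gamma)_{\gamma<\zeta}$ that has a realization satisfying (3). It is also the largest mixed sum of $(\alpha_\gamma)_{\gamma<\zeta}$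 that has a realization satisfying both (1) and (2). -/

import Mathlib

universe u v

namespace MixedSums

open Ordinal

/-- The (Hessenberg) natural sum of two ordinals: write both in Cantor normal form to base `ω` and
add the coefficients of equal powers of `ω`. -/
noncomputable def naturalSum (a b : Ordinal.{u}) : Ordinal.{u} :=
  CNF.eval ω (CNF.coeff ω a + CNF.coeff ω b)

/-- The iterated natural sum of `α γ` for `γ < δ`: `0` for `δ = 0`, natural sum with the new term at
successors, and the supremum of the earlier partial sums at limits. It only depends on the values
`α γ` with `γ < δ`. -/
noncomputable def iteratedNaturalSum (α : Ordinal.{u} → Ordinal.{u}) (δ : Ordinal.{u}) :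
    Ordinal.{u} :=
  Ordinal.limitRecOn δ 0 (fun γ s => naturalSum s (α γ))
    (fun δ _ S => ⨆ δ' : Set.Iio δ, S δ'.1 δ'.2)

theorem iteratedNaturalSum_zero (α : Ordinal.{u} → Ordinal.{u}) :
    iteratedNaturalSum α 0 = 0 := by
  simp [iteratedNaturalSum]

theorem iteratedNaturalSum_add_one (α : Ordinal.{u} → Ordinal.{u}) (δ : Ordinal.{u}) :
    iteratedNaturalSum α (δ + 1) = naturalSum (iteratedNaturalSum α δ) (α δ) := by
  simp [iteratedNaturalSum]

theorem isLUB_iteratedNaturalSum_limit (α : Ordinal.{u} → Ordinal.{u}) {δ : Ordinal.{u}}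
    (hδ : Order.IsSuccLimit δ) :
    IsLUB (iteratedNaturalSum α '' Set.Iio δ) (iteratedNaturalSum α δ) := by
  have h : iteratedNaturalSum α δ = ⨆ δ' : Set.Iio δ, iteratedNaturalSum α δ'.1 :=
    Ordinal.limitRecOn_limit (motive := fun _ => Ordinal.{u}) _ _ _ _ hδ
  have : Nonempty (Set.Iio δ) := ⟨⟨0, hδ.bot_lt⟩⟩
  rw [h, Set.image_eq_range]
  exact isLUB_ciSup Ordinal.bddAbove_of_small

/-- A set `s` of ordinals has order type `o`. (The order type of a set of ordinals of universe `u`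
lives one universe higher, hence the lift.) -/
def HasOrderType (s : Set Ordinal.{u}) (o : Ordinal.{u}) : Prop :=
  Ordinal.type (fun x y : s => x < y) = Ordinal.lift.{u + 1} o

/-- `β`, identified with the set of the ordinals `< β`, is a mixed sum of `(α i)` realized by the
pieces `(A i)`. -/
structure Realizes {I : Type v} (β : Ordinal.{u}) (α : I → Ordinal.{u})
    (A : I → Set Ordinal.{u}) : Prop where
  pairwise_disjoint : ∀ i j, i ≠ j → Disjoint (A i) (A j)
  iUnion_eq : ⋃ i, A i = Set.Iio β
  orderType : ∀ i, HasOrderType (A i) (α i)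

/-- `β` is a mixed sum of `(α i)`. -/
def IsMixedSum {I : Type v} (β : Ordinal.{u}) (α : I → Ordinal.{u}) : Prop :=
  ∃ A : I → Set Ordinal.{u}, Realizes β α A

/-- The piece `s` is convex in the realization of `β`. -/
def IsConvexPiece (β : Ordinal.{u}) (s : Set Ordinal.{u}) : Prop :=
  ∀ a ∈ s, ∀ a' ∈ s, a < a' → {b | b < β ∧ a < b ∧ b < a'} ⊆ s

/-- For every `ε < ζ` there are only finitely many `γ > ε` for which some element of
`A γ` is smaller than some element of `A ε`. -/
def FiniteOverlap {ζ : Ordinal.{u}} (A : Set.Iio ζ → Set Ordinal.{u}) : Prop :=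
  ∀ ε : Set.Iio ζ, {γ : Set.Iio ζ | ε < γ ∧ ∃ b ∈ A γ, ∃ a ∈ A ε, b < a}.Finite

/-- All but finitely many pieces are convex in the realization of `β`. -/
def AlmostAllConvex {ζ : Ordinal.{u}} (β : Ordinal.{u}) (A : Set.Iio ζ → Set Ordinal.{u}) :
    Prop :=
  {ε : Set.Iio ζ | ¬ IsConvexPiece β (A ε)}.Finite

/-- For every `ε < ζ` and every `a ∈ A ε` there are only finitely many `γ > ε` for
which some element of `A γ` is smaller than `a`. -/
def PointwiseFinite {ζ : Ordinal.{u}} (A : Set.Iio ζ → Set Ordinal.{u}) : Prop :=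
  ∀ ε : Set.Iio ζ, ∀ a ∈ A ε, {γ : Set.Iio ζ | ε < γ ∧ ∃ b ∈ A γ, b < a}.Finite

end MixedSums

namespace MixedSums

open Ordinal Set

/-! ### The natural sum -/

/-! Upper bound: if `X` and `Y` have order types at most `a` and `b`, adding the ranks of a point in
`X` and in `Y` naturally embeds `X ∪ Y` below `naturalSum a b` (`OrderTypeLE.union`). Iterating this
bounds every pointwise finite mixed sum (`orderTypeLE_iteratedNaturalSum`): at a limit, pointwise
finiteness puts everything below a given point into the pieces of a proper initial segment of
indices.

Existence is by induction on `ζ`. At a successor, `β` and the new summand are merged block by block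
along their Cantor normal forms. This needs finitely many cuts, and each cut breaks at most one
convex piece (`GoodRealization.exists_add_one`). At a limit, some partial natural sum followed by
the ordinary sum of the remaining terms already reaches the full value
(`exists_forall_iteratedNaturalSum_le`); so the remaining pieces are appended as consecutive
intervals (`GoodRealization.exists_add_tail`), which creates no new overlap and no new nonconvex
piece. The upper bound turns the resulting inequality into an equality. -/

theorem naturalSum_zero_right (a : Ordinal.{u}) : naturalSum a 0 = a := by
  simp [naturalSum]

theorem coeff_omega0_lt (a e : Ordinal.{u}) : CNF.coeff ω a e < ω := by
  by_cases h : e ∈ (CNF ω a).map Prod.fst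
  · obtain ⟨⟨e, c⟩, hc, rfl⟩ := List.mem_map.1 h
    rw [CNF.coeff_of_mem_CNF hc]
    exact CNF.snd_lt one_lt_omega0 hc
  · rw [CNF.coeff_of_notMem_CNF h]
    exact omega0_pos

theorem add_comm_of_lt_omega0 {a b : Ordinal.{u}} (ha : a < ω) (hb : b < ω) : a + b = b + a := by
  obtain ⟨n, rfl⟩ := lt_omega0.1 ha
  obtain ⟨m, rfl⟩ := lt_omega0.1 hb
  exact_mod_cast congrArg (Nat.cast (R := Ordinal.{u})) (add_comm n m)

theorem naturalSum_comm (a b : Ordinal.{u}) : naturalSum a b = naturalSum b a := by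
  rw [naturalSum, naturalSum]
  congr 1
  ext e
  exact add_comm_of_lt_omega0 (coeff_omega0_lt a e) (coeff_omega0_lt b e)

theorem lt_of_mem_support_coeff {a e e' : Ordinal.{u}} (h : a < ω ^ e)
    (he' : e' ∈ (CNF.coeff ω a).support) : e' < e := by
  by_contra! hle
  exact Finsupp.mem_support_iff.1 he'
    (CNF.coeff_eq_zero_of_lt (h.trans_le (opow_le_opow_right omega0_pos hle)))

theorem lt_of_mem_support_coeff_add {a b e e' : Ordinal.{u}} (ha : a < ω ^ e) (hb : b < ω ^ e)
    (he' : e' ∈ (CNF.coeff ω a + CNF.coeff ω b).support) : e' < e := by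
  rcases Finset.mem_union.1 (Finsupp.support_add he') with h | h
  · exact lt_of_mem_support_coeff ha h
  · exact lt_of_mem_support_coeff hb h

theorem coeff_add_coeff_lt (a b e : Ordinal.{u}) :
    (CNF.coeff ω a + CNF.coeff ω b) e < ω :=
  isPrincipal_add_omega0 (coeff_omega0_lt a e) (coeff_omega0_lt b e)

theorem naturalSum_lt_opow {a b e : Ordinal.{u}} (ha : a < ω ^ e) (hb : b < ω ^ e) :
    naturalSum a b < ω ^ e :=
  CNF.eval_lt (coeff_add_coeff_lt a b) fun _ => lt_of_mem_support_coeff_add ha hb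

theorem coeff_opow_mul_add' {e n r : Ordinal.{u}} (hn : n < ω) (hr : r < ω ^ e) :
    CNF.coeff ω (ω ^ e * n + r) = Finsupp.single e n + CNF.coeff ω r := by
  obtain rfl | h := eq_or_ne n 0
  · simp
  · exact CNF.coeff_opow_mul_add one_lt_omega0 h hn hr

theorem naturalSum_opow_mul_add {e n m r s : Ordinal.{u}} (hn : n < ω) (hm : m < ω)
    (hr : r < ω ^ e) (hs : s < ω ^ e) :
    naturalSum (ω ^ e * n + r) (ω ^ e * m + s) = ω ^ e * (n + m) + naturalSum r s := by
  rw [naturalSum, coeff_opow_mul_add' hn hr, coeff_opow_mul_add' hm hs]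
  have : Finsupp.single e n + CNF.coeff ω r + (Finsupp.single e m + CNF.coeff ω s) =
      Finsupp.single e (n + m) + (CNF.coeff ω r + CNF.coeff ω s) := by
    ext x
    obtain rfl | hx := eq_or_ne x e
    · simp [CNF.coeff_eq_zero_of_lt hr, CNF.coeff_eq_zero_of_lt hs]
    · simp [hx]
  rw [this, CNF.eval_single_add', naturalSum]
  exact fun _ => lt_of_mem_support_coeff_add hr hs

theorem eq_opow_mul_add {e a : Ordinal.{u}} (h : a < ω ^ (e + 1)) :
    ∃ n < ω, ∃ r < ω ^ e, a = ω ^ e * n + r := by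
  have h0 : (ω : Ordinal.{u}) ^ e ≠ 0 := opow_ne_zero _ omega0_ne_zero
  refine ⟨a / ω ^ e, ?_, a % ω ^ e, mod_lt _ h0, (div_add_mod _ _).symm⟩
  rw [← lt_mul_iff_div_lt h0]
  rwa [opow_add, opow_one] at h

theorem opow_mul_add_lt {e n m r s : Ordinal.{u}} (hr : r < ω ^ e) (h : n < m) :
    ω ^ e * n + r < ω ^ e * m + s :=
  calc ω ^ e * n + r < ω ^ e * n + ω ^ e := by gcongr
    _ = ω ^ e * (n + 1) := by rw [mul_add, mul_one]
    _ ≤ ω ^ e * m := by gcongr; exact Order.add_one_le_of_lt h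
    _ ≤ ω ^ e * m + s := le_self_add

/-- The bound `ω ^ e` only serves the induction: at a successor exponent the leading coefficients
are compared, and a tie passes to the remainders below `ω ^ e`. -/
theorem naturalSum_lt_naturalSum_of_lt_opow (e : Ordinal.{u}) : ∀ {a b c : Ordinal.{u}},
    a < b → b < ω ^ e → c < ω ^ e → naturalSum a c < naturalSum b c := by
  induction e using Ordinal.limitRecOn with
  | zero =>
    intro a b c hab hb _
    simp only [opow_zero, Order.lt_one_iff] at hb
    simp [hb] at hab
  | add_one e ih =>
    intro a b c hab hb hc
    obtain ⟨n, hn, r, hr, rfl⟩ := eq_opow_mul_add (hab.trans hb)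
    obtain ⟨m, hm, s, hs, rfl⟩ := eq_opow_mul_add hb
    obtain ⟨k, hk, t, ht, rfl⟩ := eq_opow_mul_add hc
    rw [naturalSum_opow_mul_add hn hk hr ht, naturalSum_opow_mul_add hm hk hs ht]
    rcases lt_trichotomy n m with h | rfl | h
    · refine opow_mul_add_lt (naturalSum_lt_opow hr ht) ?_
      obtain ⟨n, rfl⟩ := lt_omega0.1 hn
      obtain ⟨m, rfl⟩ := lt_omega0.1 hm
      obtain ⟨k, rfl⟩ := lt_omega0.1 hk
      norm_cast at h ⊢
      omega
    · gcongr
      exact ih (by simpa using hab) hs ht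
    · exact absurd hab (opow_mul_add_lt hs h).asymm
  | limit e he ih =>
    intro a b c hab hb hc
    have := (lt_opow_of_isSuccLimit omega0_ne_zero he).1 (max_lt hb hc)
    obtain ⟨e', he', h⟩ := this
    exact ih e' he' hab (max_lt_iff.1 h).1 (max_lt_iff.1 h).2

theorem exists_lt_omega0_opow (a b : Ordinal.{u}) : ∃ e : Ordinal.{u}, a < ω ^ e ∧ b < ω ^ e := by
  refine ⟨max a b + 1, ?_⟩
  rw [← max_lt_iff]
  exact (lt_add_one _).trans_le (right_le_opow _ one_lt_omega0)

theorem naturalSum_lt_naturalSum_left {a b : Ordinal.{u}} (h : a < b) (c : Ordinal.{u}) :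
    naturalSum a c < naturalSum b c := by
  obtain ⟨e, hb, hc⟩ := exists_lt_omega0_opow b c
  exact naturalSum_lt_naturalSum_of_lt_opow e h hb hc

theorem strictMono_naturalSum_left (c : Ordinal.{u}) : StrictMono fun a => naturalSum a c :=
  fun _ _ h => naturalSum_lt_naturalSum_left h c

theorem naturalSum_lt_naturalSum_right {a b : Ordinal.{u}} (h : a < b) (c : Ordinal.{u}) :
    naturalSum c a < naturalSum c b := by
  simpa only [naturalSum_comm c] using naturalSum_lt_naturalSum_left h c

theorem naturalSum_le_naturalSum {a b c d : Ordinal.{u}} (h : a ≤ b) (h' : c ≤ d) :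
    naturalSum a c ≤ naturalSum b d := by
  refine ((strictMono_naturalSum_left c).monotone h).trans ?_
  simpa only [naturalSum_comm b] using (strictMono_naturalSum_left b).monotone h'

theorem naturalSum_lt_naturalSum_of_lt_of_le {a b c d : Ordinal.{u}} (h : a < b) (h' : c ≤ d) :
    naturalSum a c < naturalSum b d :=
  (naturalSum_lt_naturalSum_left h c).trans_le (naturalSum_le_naturalSum le_rfl h')

theorem naturalSum_lt_naturalSum_of_le_of_lt {a b c d : Ordinal.{u}} (h : a ≤ b) (h' : c < d) :
    naturalSum a c < naturalSum b d :=
  (naturalSum_lt_naturalSum_right h' a).trans_le (naturalSum_le_naturalSum h le_rfl)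

theorem le_naturalSum_left (a b : Ordinal.{u}) : a ≤ naturalSum a b := by
  conv_lhs => rw [← naturalSum_zero_right a]
  exact naturalSum_le_naturalSum le_rfl zero_le

/-- Every ordinal splits as `σ + τ` with `τ < ω ^ e`, where `σ` consists of the terms of the Cantor
normal form with exponent at least `e`; natural sums with ordinals below `ω ^ e` only affect
the second part. -/
theorem exists_add_and_naturalSum_add (a e : Ordinal.{u}) : ∃ σ, (∃ τ < ω ^ e, a = σ + τ) ∧
    ∀ τ < ω ^ e, ∀ b < ω ^ e, naturalSum (σ + τ) b = σ + naturalSum τ b := by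
  set f := CNF.coeff ω a with hf
  set g := f.filter (fun x => e ≤ x) with hg
  have hgsupp : ∀ x ∈ g.support, e ≤ x := fun x hx => by
    simp only [hg, Finsupp.support_filter, Finset.mem_filter] at hx
    exact hx.2
  have hgle : ∀ x, g x < ω := fun x => by
    rw [hg, Finsupp.filter_apply]
    split_ifs
    exacts [coeff_omega0_lt a x, omega0_pos]
  refine ⟨CNF.eval ω g, ⟨CNF.eval ω (f.filter fun x => ¬ e ≤ x), ?_, ?_⟩, ?_⟩
  · refine CNF.eval_lt (fun x => ?_) fun x hx => ?_
    · rw [Finsupp.filter_apply]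
      split_ifs
      exacts [omega0_pos, coeff_omega0_lt a x]
    · simp only [Finsupp.support_filter, Finset.mem_filter] at hx
      exact not_le.1 hx.2
  · have hfg : g + f.filter (fun x => ¬ e ≤ x) = f := by
      ext x
      by_cases h : e ≤ x <;> simp [hg, Finsupp.filter_apply, h]
    rw [← CNF.eval_add, hfg, hf, CNF.eval_coeff]
    intro x hx y hy
    simp only [Finsupp.support_filter, Finset.mem_filter] at hy
    exact (not_le.1 hy.2).le.trans (hgsupp x hx)
  · intro τ hτ b hb
    have h1 : CNF.coeff ω (CNF.eval ω g + τ) = g + CNF.coeff ω τ := by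
      conv_lhs => rw [← CNF.eval_coeff ω τ]
      rw [← CNF.eval_add, CNF.coeff_eval one_lt_omega0]
      · exact fun x => isPrincipal_add_omega0 (hgle x) (coeff_omega0_lt τ x)
      · exact fun x hx y hy => (lt_of_mem_support_coeff hτ hy).le.trans (hgsupp x hx)
    rw [naturalSum, h1, add_assoc, CNF.eval_add, naturalSum]
    exact fun x hx y hy => (lt_of_mem_support_coeff_add hτ hb hy).le.trans (hgsupp x hx)

/-! ### Embedding sets of ordinals below an ordinal -/

/-- The position of `x` relative to the set `X`: the order type of `X ∩ Iio x`. -/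
noncomputable def setRank (X : Set Ordinal.{u}) (x : Ordinal.{u}) : Ordinal.{u} :=
  sInf {z | ∀ y, ∀ _ : y < x, y ∈ X → setRank X y < z}
termination_by x

theorem setRank_le_of_forall_lt {X : Set Ordinal.{u}} {x z : Ordinal.{u}}
    (h : ∀ y < x, y ∈ X → setRank X y < z) : setRank X x ≤ z := by
  rw [setRank]
  exact csInf_le' h

/-- The rank is the least strictly increasing function on `X`, so any strictly increasing map bounds
an order type. -/
theorem setRank_le_of_strictMonoOn {X : Set Ordinal.{u}} {f : Ordinal.{u} → Ordinal.{u}}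
    (hf : StrictMonoOn f X) {x : Ordinal.{u}} (hx : x ∈ X) : setRank X x ≤ f x := by
  induction x using WellFoundedLT.induction with
  | ind x ih => exact setRank_le_of_forall_lt fun y hy hyX => (ih y hy hyX).trans_lt (hf hyX hx hy)

theorem setRank_lt_setRank {X : Set Ordinal.{u}} {x y : Ordinal.{u}} (hy : y ∈ X) (h : y < x) :
    setRank X y < setRank X x := by
  -- The infimum of the empty set would be `0`; the point `x` itself is an admissible bound.
  have hne : {z | ∀ y, ∀ _ : y < x, y ∈ X → setRank X y < z}.Nonempty :=
    ⟨x, fun y hy hyX => (setRank_le_of_strictMonoOn strictMonoOn_id hyX).trans_lt hy⟩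
  have := csInf_mem hne y h hy
  rwa [← setRank] at this

theorem setRank_le_setRank {X Y : Set Ordinal.{u}} {x : Ordinal.{u}}
    (h : ∀ y ∈ X, y < x → y ∈ Y) : setRank X x ≤ setRank Y x := by
  induction x using WellFoundedLT.induction with
  | ind x ih =>
    refine setRank_le_of_forall_lt fun y hy hyX => ?_
    exact (ih y hy fun z hz hzy => h z hz (hzy.trans hy)).trans_lt
      (setRank_lt_setRank (h y hyX hy) hy)

/-- The order type of the set `X` is at most `o`. -/
def OrderTypeLE (X : Set Ordinal.{u}) (o : Ordinal.{u}) : Prop :=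
  ∀ x ∈ X, setRank X x < o

theorem OrderTypeLE.of_strictMonoOn {X : Set Ordinal.{u}} {o : Ordinal.{u}}
    {f : Ordinal.{u} → Ordinal.{u}} (hf : StrictMonoOn f X) (h : ∀ x ∈ X, f x < o) :
    OrderTypeLE X o :=
  fun x hx => (setRank_le_of_strictMonoOn hf hx).trans_lt (h x hx)

theorem OrderTypeLE.mono {X Y : Set Ordinal.{u}} {o : Ordinal.{u}} (h : OrderTypeLE Y o)
    (hXY : X ⊆ Y) : OrderTypeLE X o :=
  fun x hx => (setRank_le_setRank fun _ hy _ => hXY hy).trans_lt (h x (hXY hx))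

theorem OrderTypeLE.setRank_le {X : Set Ordinal.{u}} {o : Ordinal.{u}} (h : OrderTypeLE X o)
    (x : Ordinal.{u}) : setRank X x ≤ o :=
  setRank_le_of_forall_lt fun y _ hy => h y hy

/-- Passing a point of `X` or of `Y` raises one of the two ranks strictly and does not lower the
other, and `naturalSum` is strictly increasing in each argument. -/
theorem OrderTypeLE.union {X Y : Set Ordinal.{u}} {a b : Ordinal.{u}} (hX : OrderTypeLE X a)
    (hY : OrderTypeLE Y b) : OrderTypeLE (X ∪ Y) (naturalSum a b) := by
  have mono : ∀ (Z : Set Ordinal.{u}) {x y : Ordinal.{u}}, x ≤ y → setRank Z x ≤ setRank Z y :=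
    fun Z x y hxy => setRank_le_of_forall_lt fun z hz hzZ =>
      setRank_lt_setRank hzZ (hz.trans_le hxy)
  refine .of_strictMonoOn (f := fun x => naturalSum (setRank X x) (setRank Y x)) ?_ ?_
  · rintro x (hx | hx) y - hxy
    · exact naturalSum_lt_naturalSum_of_lt_of_le (setRank_lt_setRank hx hxy) (mono Y hxy.le)
    · exact naturalSum_lt_naturalSum_of_le_of_lt (mono X hxy.le) (setRank_lt_setRank hx hxy)
  · rintro x (hx | hx)
    · exact naturalSum_lt_naturalSum_of_lt_of_le (hX x hx) (hY.setRank_le x)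
    · exact naturalSum_lt_naturalSum_of_le_of_lt (hX.setRank_le x) (hY x hx)

/-- If `o < β`, then `o` is itself a point of `Iio β`, and its rank there is at least `o`. -/
theorem le_of_orderTypeLE_Iio {β o : Ordinal.{u}} (h : OrderTypeLE (Iio β) o) : β ≤ o := by
  by_contra! hlt
  have key : ∀ x < β, x ≤ setRank (Iio β) x := by
    intro x
    induction x using WellFoundedLT.induction with
    | ind x ih =>
      intro hx
      refine le_of_forall_lt fun y hy => ?_
      exact (ih y hy (hy.trans hx)).trans_lt (setRank_lt_setRank (hy.trans hx) hy)
  exact (key o hlt).not_gt (h o hlt)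

/-! ### Order types of sets of ordinals -/

/-- Replaces isomorphisms of subtypes, one universe up, by increasing enumerations, which compose
and glue easily. -/
theorem hasOrderType_iff {s : Set Ordinal.{u}} {o : Ordinal.{u}} :
    HasOrderType s o ↔
      ∃ f : Ordinal.{u} → Ordinal.{u}, StrictMonoOn f (Iio o) ∧ f '' Iio o = s := by
  rw [HasOrderType, ← type_lt_Iio, type_eq]
  constructor
  · rintro ⟨e⟩
    refine ⟨fun x => if h : x < o then e.symm ⟨x, h⟩ else 0, ?_, ?_⟩
    · intro x hx y hy hxy
      simp only [mem_Iio.1 hx, mem_Iio.1 hy, dif_pos]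
      exact e.symm.map_rel_iff.2 (show (⟨x, hx⟩ : Iio o) < ⟨y, hy⟩ from hxy)
    · ext y
      constructor
      · rintro ⟨x, hx, rfl⟩
        simp only [mem_Iio.1 hx, dif_pos]
        exact Subtype.coe_prop _
      · intro hy
        refine ⟨e ⟨y, hy⟩, (e ⟨y, hy⟩).2, ?_⟩
        have : (e ⟨y, hy⟩ : Ordinal) < o := (e ⟨y, hy⟩).2
        simp only [this, dif_pos]
        exact congrArg Subtype.val (e.symm_apply_apply ⟨y, hy⟩)
  · rintro ⟨f, hf, rfl⟩
    exact ⟨(RelIso.mk (Equiv.Set.imageOfInjOn f _ hf.injOn)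
      (fun {a b} => hf.lt_iff_lt a.2 b.2)).symm⟩

theorem HasOrderType.orderTypeLE {s : Set Ordinal.{u}} {o : Ordinal.{u}} (h : HasOrderType s o) :
    OrderTypeLE s o := by
  obtain ⟨f, hf, rfl⟩ := hasOrderType_iff.1 h
  have hinv : ∀ x ∈ f '' Iio o, Function.invFunOn f (Iio o) x ∈ Iio o ∧
      f (Function.invFunOn f (Iio o) x) = x :=
    fun x hx => ⟨Function.invFunOn_mem hx, Function.invFunOn_eq hx⟩
  refine .of_strictMonoOn (f := Function.invFunOn f (Iio o)) ?_ fun x hx => (hinv x hx).1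
  intro x hx y hy hxy
  rw [← (hinv x hx).2, ← (hinv y hy).2] at hxy
  exact (hf.lt_iff_lt (hinv x hx).1 (hinv y hy).1).1 hxy

theorem hasOrderType_Iio (o : Ordinal.{u}) : HasOrderType (Iio o) o :=
  hasOrderType_iff.2 ⟨id, strictMonoOn_id, image_id _⟩

theorem HasOrderType.image {s : Set Ordinal.{u}} {o : Ordinal.{u}} (h : HasOrderType s o)
    {g : Ordinal.{u} → Ordinal.{u}} (hg : StrictMonoOn g s) : HasOrderType (g '' s) o := by
  obtain ⟨f, hf, rfl⟩ := hasOrderType_iff.1 h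
  exact hasOrderType_iff.2 ⟨g ∘ f, hg.comp hf (mapsTo_image f _), image_comp g f _⟩

theorem image_add_left_Iio (a b : Ordinal.{u}) : (a + ·) '' Iio b = Ico a (a + b) := by
  ext x
  constructor
  · rintro ⟨y, hy, rfl⟩
    exact ⟨le_self_add, by simpa using hy⟩
  · rintro ⟨h1, h2⟩
    refine ⟨x - a, ?_, Ordinal.add_sub_cancel_of_le h1⟩
    rw [← Ordinal.add_sub_cancel_of_le h1] at h2
    simpa using h2

theorem strictMono_add_left (a : Ordinal.{u}) : StrictMono (a + ·) :=
  fun _ _ h => by simpa using h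

theorem hasOrderType_Ico_add (a b : Ordinal.{u}) : HasOrderType (Ico a (a + b)) b := by
  rw [← image_add_left_Iio]
  exact (hasOrderType_Iio b).image ((strictMono_add_left a).strictMonoOn _)

theorem HasOrderType.union {s t : Set Ordinal.{u}} {a b : Ordinal.{u}} (hs : HasOrderType s a)
    (ht : HasOrderType t b) (h : ∀ x ∈ s, ∀ y ∈ t, x < y) : HasOrderType (s ∪ t) (a + b) := by
  obtain ⟨f, hf, rfl⟩ := hasOrderType_iff.1 hs
  obtain ⟨g, hg, rfl⟩ := hasOrderType_iff.1 ht
  have hsub : ∀ x, a ≤ x → x < a + b → x - a < b := fun x hx hxb => by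
    rw [← Ordinal.add_sub_cancel_of_le hx] at hxb
    simpa using hxb
  refine hasOrderType_iff.2 ⟨fun x => if x < a then f x else g (x - a), ?_, ?_⟩
  · intro x hx y hy hxy
    dsimp only
    split_ifs with h1 h2 h2
    · exact hf h1 h2 hxy
    · exact h _ (mem_image_of_mem f h1) _ (mem_image_of_mem g (hsub y (not_lt.1 h2) hy))
    · exact absurd (hxy.trans h2) h1
    · refine hg (hsub x (not_lt.1 h1) hx) (hsub y (not_lt.1 h2) hy) ?_
      rw [Ordinal.lt_sub, Ordinal.add_sub_cancel_of_le (not_lt.1 h1)]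
      exact hxy
  · ext z
    constructor
    · rintro ⟨x, hx, rfl⟩
      dsimp only
      split_ifs with h1
      · exact Or.inl (mem_image_of_mem f h1)
      · exact Or.inr (mem_image_of_mem g (hsub x (not_lt.1 h1) hx))
    · rintro (⟨x, hx, rfl⟩ | ⟨x, hx, rfl⟩)
      · exact ⟨x, (mem_Iio.1 hx).trans_le le_self_add, if_pos hx⟩
      · refine ⟨a + x, by simpa using hx, ?_⟩
        simp

/-! ### The iterated natural sum bounds pointwise finite mixed sums -/

theorem iteratedNaturalSum_mono (α : Ordinal.{u} → Ordinal.{u}) :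
    Monotone (iteratedNaturalSum α) := by
  intro a b
  induction b using Ordinal.limitRecOn with
  | zero => intro h; rw [nonpos_iff_eq_zero.1 h]
  | add_one b ih =>
    intro h
    rcases h.eq_or_lt with rfl | h
    · rfl
    · rw [iteratedNaturalSum_add_one]
      exact (ih (Order.lt_add_one_iff.1 h)).trans (le_naturalSum_left _ _)
  | limit b hb ih =>
    intro h
    rcases h.eq_or_lt with rfl | h
    · rfl
    · exact (isLUB_iteratedNaturalSum_limit α hb).1 (mem_image_of_mem _ h)

theorem exists_lt_of_isSuccLimit_of_finite {δ : Ordinal.{u}} (hδ : Order.IsSuccLimit δ)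
    {s : Set Ordinal.{u}} (hs : s.Finite) (h : ∀ x ∈ s, x < δ) : ∃ δ' < δ, ∀ x ∈ s, x < δ' := by
  induction s, hs using Set.Finite.induction_on with
  | empty => exact ⟨0, hδ.bot_lt, by simp⟩
  | @insert a s _ _ ih =>
    obtain ⟨δ', hδ', h'⟩ := ih fun x hx => h x (mem_insert_of_mem a hx)
    refine ⟨max δ' (a + 1), max_lt hδ' (hδ.add_one_lt (h a (mem_insert a s))), ?_⟩
    rintro x (rfl | hx)
    · exact lt_max_of_lt_right (lt_add_one _)
    · exact lt_max_of_lt_left (h' x hx)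

theorem orderTypeLE_iteratedNaturalSum (α : Ordinal.{u} → Ordinal.{u})
    (A : Ordinal.{u} → Set Ordinal.{u}) (δ : Ordinal.{u}) (hα : ∀ γ < δ, OrderTypeLE (A γ) (α γ))
    (hA : ∀ ε < δ, ∀ a ∈ A ε, {γ | γ < δ ∧ ε < γ ∧ ∃ b ∈ A γ, b < a}.Finite) :
    OrderTypeLE (⋃ γ < δ, A γ) (iteratedNaturalSum α δ) := by
  induction δ using WellFoundedLT.induction with
  | ind δ ih =>
  have ih' : ∀ δ' < δ, OrderTypeLE (⋃ γ < δ', A γ) (iteratedNaturalSum α δ') := fun δ' h =>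
    ih δ' h (fun γ hγ => hα γ (hγ.trans h)) fun ε hε a ha =>
      (hA ε (hε.trans h) a ha).subset fun γ hγ => ⟨hγ.1.trans h, hγ.2⟩
  induction δ using Ordinal.limitRecOn with
  | zero => intro x hx; simp at hx
  | add_one δ =>
    rw [iteratedNaturalSum_add_one]
    refine ((ih' δ (lt_add_one δ)).union (hα δ (lt_add_one δ))).mono ?_
    intro x hx
    simp only [mem_iUnion, exists_prop] at hx
    obtain ⟨γ, hγ, hx⟩ := hx
    rcases (Order.lt_add_one_iff.1 hγ).eq_or_lt with rfl | hγ
    · exact Or.inr hx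
    · exact Or.inl (mem_iUnion₂.2 ⟨γ, hγ, hx⟩)
  | limit δ hδ =>
    intro a ha
    obtain ⟨ε, hε, ha⟩ := mem_iUnion₂.1 ha
    obtain ⟨δ', hδ', h⟩ := exists_lt_of_isSuccLimit_of_finite hδ (hA ε hε a ha) fun _ hx => hx.1
    have hm : max δ' (ε + 1) < δ := max_lt hδ' (hδ.add_one_lt hε)
    refine lt_of_le_of_lt ?_ ((ih' _ hm a (mem_iUnion₂.2
      ⟨ε, lt_max_of_lt_right (lt_add_one ε), ha⟩)).trans_le (iteratedNaturalSum_mono α hm.le))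
    -- The rank of `a` depends only on the points below `a`, and these all lie in pieces of index
    -- below `max δ' (ε + 1)`.
    refine setRank_le_setRank fun b hb hba => ?_
    obtain ⟨γ, hγ, hb⟩ := mem_iUnion₂.1 hb
    refine mem_iUnion₂.2 ⟨γ, ?_, hb⟩
    rcases le_or_gt γ ε with h' | h'
    · exact lt_max_of_lt_right (Order.lt_add_one_iff.2 h')
    · exact lt_max_of_lt_left (h γ ⟨hγ, h', b, hb, hba⟩)

/-! ### Ordinary sums -/

/-- The ordinary (non-commutative) sum of `α γ` for `γ < δ`. -/
noncomputable def ordinalSum (α : Ordinal.{u} → Ordinal.{u}) (δ : Ordinal.{u}) : Ordinal.{u} :=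
  Ordinal.limitRecOn δ 0 (fun γ s => s + α γ) (fun δ _ S => ⨆ δ' : Set.Iio δ, S δ'.1 δ'.2)

theorem ordinalSum_add_one (α : Ordinal.{u} → Ordinal.{u}) (δ : Ordinal.{u}) :
    ordinalSum α (δ + 1) = ordinalSum α δ + α δ := by
  simp [ordinalSum]

theorem lt_ordinalSum_limit (α : Ordinal.{u} → Ordinal.{u}) {δ x : Ordinal.{u}}
    (hδ : Order.IsSuccLimit δ) : x < ordinalSum α δ ↔ ∃ δ' < δ, x < ordinalSum α δ' := by
  have h : ordinalSum α δ = ⨆ δ' : Set.Iio δ, ordinalSum α δ'.1 :=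
    Ordinal.limitRecOn_limit (motive := fun _ => Ordinal.{u}) _ _ _ _ hδ
  rw [h, Ordinal.lt_iSup_iff]
  simp

theorem ordinalSum_mono (α : Ordinal.{u} → Ordinal.{u}) : Monotone (ordinalSum α) := by
  intro a b
  induction b using Ordinal.limitRecOn with
  | zero => intro h; rw [nonpos_iff_eq_zero.1 h]
  | add_one b ih =>
    intro h
    rcases h.eq_or_lt with rfl | h
    · rfl
    · rw [ordinalSum_add_one]
      exact (ih (Order.lt_add_one_iff.1 h)).trans le_self_add
  | limit b hb ih =>
    intro h
    rcases h.eq_or_lt with rfl | h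
    · rfl
    · exact le_of_forall_lt fun x hx => (lt_ordinalSum_limit α hb).2 ⟨a, h, hx⟩

theorem ordinalSum_sub_add_one (α : Ordinal.{u} → Ordinal.{u}) {δ₀ δ : Ordinal.{u}}
    (h : δ₀ ≤ δ) : ordinalSum α (δ + 1) - ordinalSum α δ₀ =
      ordinalSum α δ - ordinalSum α δ₀ + α δ := by
  apply add_left_cancel (a := ordinalSum α δ₀)
  rw [← add_assoc, Ordinal.add_sub_cancel_of_le (ordinalSum_mono α h),
    Ordinal.add_sub_cancel_of_le (ordinalSum_mono α (h.trans le_self_add)), ordinalSum_add_one]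

theorem ordinalSum_sub_add_sub (α : Ordinal.{u} → Ordinal.{u}) {a b c : Ordinal.{u}}
    (h : a ≤ b) (h' : b ≤ c) :
    ordinalSum α b - ordinalSum α a + (ordinalSum α c - ordinalSum α b) =
      ordinalSum α c - ordinalSum α a := by
  apply add_left_cancel (a := ordinalSum α a)
  rw [← add_assoc, Ordinal.add_sub_cancel_of_le (ordinalSum_mono α h),
    Ordinal.add_sub_cancel_of_le (ordinalSum_mono α h'),
    Ordinal.add_sub_cancel_of_le (ordinalSum_mono α (h.trans h'))]

theorem sub_le_sub_right' {a b : Ordinal.{u}} (h : a ≤ b) (c : Ordinal.{u}) : a - c ≤ b - c :=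
  Ordinal.sub_le.2 (h.trans (Ordinal.le_add_sub b c))

/-- The degenerate case of the limit analysis, where the ordinary sum of the tail vanishes. -/
theorem iteratedNaturalSum_le_of_tail_eq_zero {α : Ordinal.{u} → Ordinal.{u}} {δ₁ ζ : Ordinal.{u}}
    (h : ∀ δ, δ₁ ≤ δ → δ < ζ → α δ = 0) (h₁ : δ₁ ≤ ζ) :
    iteratedNaturalSum α ζ ≤ iteratedNaturalSum α δ₁ := by
  induction ζ using Ordinal.limitRecOn with
  | zero => rw [nonpos_iff_eq_zero.1 h₁]
  | add_one ζ ih =>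
    rcases h₁.eq_or_lt with rfl | h₁
    · rfl
    · have h₁ := Order.lt_add_one_iff.1 h₁
      rw [iteratedNaturalSum_add_one, h ζ h₁ (lt_add_one ζ), naturalSum_zero_right]
      exact ih (fun δ hδ hδζ => h δ hδ (hδζ.trans (lt_add_one ζ))) h₁
  | limit ζ hζ ih =>
    refine (isLUB_iteratedNaturalSum_limit α hζ).2 ?_
    rintro _ ⟨δ, hδ, rfl⟩
    rcases le_total δ δ₁ with h' | h'
    · exact iteratedNaturalSum_mono α h'
    · exact ih δ hδ (fun x hx hxδ => h x hx (hxδ.trans hδ)) h'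

/-- At a limit, the iterated natural sum is attained by a partial iterated natural sum followed by
the ordinary sum of the remaining terms. -/
theorem exists_forall_iteratedNaturalSum_le (α : Ordinal.{u} → Ordinal.{u}) {ζ : Ordinal.{u}}
    (hζ : Order.IsSuccLimit ζ) : ∃ δ₀ < ζ, ∀ δ, δ₀ ≤ δ → δ < ζ →
      iteratedNaturalSum α ζ ≤ iteratedNaturalSum α δ + (ordinalSum α ζ - ordinalSum α δ) := by
  induction ζ using WellFoundedLT.induction with
  | ind ζ ih =>
  set W := ordinalSum α
  set S := iteratedNaturalSum α
  -- The least tail `ρ` is attained at some `δ₁`; later tails are end segments of it, so they all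
  -- equal `ρ`.
  obtain ⟨δ₁, hδ₁, hmin⟩ : ∃ δ₁ < ζ, ∀ δ < ζ, W ζ - W δ₁ ≤ W ζ - W δ := by
    obtain ⟨-, ⟨δ₁, h, rfl⟩, h'⟩ := WellFounded.has_min (wellFounded_lt (α := Ordinal.{u}))
      ((fun δ => W ζ - W δ) '' Iio ζ) ⟨_, mem_image_of_mem _ (mem_Iio.2 hζ.bot_lt)⟩
    exact ⟨δ₁, h, fun δ hδ => not_lt.1 (h' _ (mem_image_of_mem _ hδ))⟩
  set ρ := W ζ - W δ₁ with hρ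
  have htail : ∀ δ, δ₁ ≤ δ → δ < ζ → W ζ - W δ = ρ := fun δ h h' =>
    (le_add_self.trans_eq (ordinalSum_sub_add_sub α h h'.le)).antisymm (hmin δ h')
  have hadd : ∀ δ, δ₁ ≤ δ → δ < ζ → W δ - W δ₁ + ρ = ρ := fun δ h h' => by
    conv_lhs => rw [← htail δ h h']
    exact ordinalSum_sub_add_sub α h h'.le
  refine ⟨δ₁, hδ₁, fun δ h h' => ?_⟩
  rw [htail δ h h']
  suffices S ζ ≤ S δ₁ + ρ from
    this.trans (add_le_add_left (iteratedNaturalSum_mono α h) ρ)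
  obtain hρ0 | hρ0 := eq_or_ne ρ 0
  · rw [hρ0, add_zero]
    refine iteratedNaturalSum_le_of_tail_eq_zero (fun δ h h' => ?_) hδ₁.le
    have := ordinalSum_sub_add_sub α (le_self_add : δ ≤ δ + 1) (hζ.add_one_lt h').le
    rw [ordinalSum_sub_add_one α le_rfl, Ordinal.sub_self, zero_add,
      htail δ h h', hρ0] at this
    exact (by simpa using this : α δ = 0 ∧ _).1
  -- A partial sum equal to `ρ` would give `ρ + ρ = ρ`, hence `ρ = 0`.
  have hlt : ∀ δ, δ₁ ≤ δ → δ < ζ → W δ - W δ₁ < ρ := fun δ h h' => by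
    have h1 := hadd δ h h'
    refine lt_of_le_of_ne (h1 ▸ le_self_add) fun h2 => hρ0 ?_
    rw [h2] at h1
    simpa using h1
  -- Any `x < ρ` lies below a partial sum of the tail, and `ρ` absorbs that; hence `ρ` is a power `ω
  -- ^ θ`.
  have hprin : IsPrincipal (· + ·) ρ := by
    refine isPrincipal_add_iff_add_left_eq_self.2 fun x hx => le_antisymm ?_ le_add_self
    rw [hρ, Ordinal.lt_sub, lt_ordinalSum_limit α hζ] at hx
    obtain ⟨δ, hδ, hx⟩ := hx
    have hle : δ₁ ≤ δ := by
      by_contra! hlt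
      exact (le_self_add.trans_lt hx).not_ge (ordinalSum_mono α hlt.le)
    calc x + ρ ≤ W δ - W δ₁ + ρ := add_le_add_left (Ordinal.lt_sub.2 hx).le ρ
      _ = ρ := hadd δ hle hδ
  obtain ⟨θ, hθ⟩ := (isPrincipal_add_iff_zero_or_omega0_opow.1 hprin).resolve_left hρ0
  have hθ : ρ = ω ^ θ := hθ.symm
  obtain ⟨σ, ⟨τ₁, hτ₁, hS₁⟩, hσ⟩ := exists_add_and_naturalSum_add (S δ₁) θ
  have hsub : ∀ a b, δ₁ ≤ a → a ≤ b → b < ζ → W b - W a < ρ := fun a b h h' h'' =>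
    (le_add_self.trans_eq (ordinalSum_sub_add_sub α h h')).trans_lt (hlt b (h.trans h') h'')
  have hσS : ∀ δ, δ₁ ≤ δ → σ ≤ S δ := fun δ h =>
    (hS₁ ▸ le_self_add : σ ≤ S δ₁).trans (iteratedNaturalSum_mono α h)
  have hsplit : ∀ δ, δ₁ ≤ δ → S δ < σ + ρ → ∃ τ < ω ^ θ, S δ = σ + τ := fun δ h h' => by
    refine ⟨S δ - σ, ?_, (Ordinal.add_sub_cancel_of_le (hσS δ h)).symm⟩
    rw [← hθ]
    rw [← Ordinal.add_sub_cancel_of_le (hσS δ h)] at h'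
    exact (add_lt_add_iff_left σ).1 h'
  -- From `δ₁` on, the part `σ` with exponents at least `θ` stays fixed, and everything added
  -- remains below `ω ^ θ`.
  have key : ∀ δ, δ₁ ≤ δ → δ < ζ → S δ < σ + ρ := by
    intro δ
    induction δ using WellFoundedLT.induction with
    | ind δ IH =>
    intro h h'
    rcases h.eq_or_lt with rfl | h1
    · rw [hS₁, hθ]
      exact (add_lt_add_iff_left σ).2 hτ₁
    rcases zero_or_succ_or_isSuccLimit δ with rfl | ⟨δ, rfl⟩ | hδ
    · simp at h1
    · rw [Order.succ_eq_add_one] at *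
      have h2 : δ₁ ≤ δ := Order.lt_add_one_iff.1 h1
      obtain ⟨τ, hτ, hSδ⟩ := hsplit δ h2 (IH δ (lt_add_one δ) h2 ((lt_add_one δ).trans h'))
      have hα : α δ < ω ^ θ := by
        have := hsub δ (δ + 1) h2 le_self_add h'
        rwa [ordinalSum_sub_add_one α le_rfl, Ordinal.sub_self, zero_add, hθ] at this
      rw [show S (δ + 1) = naturalSum (S δ) (α δ) from iteratedNaturalSum_add_one α δ, hSδ,
        hσ τ hτ _ hα, hθ]
      exact (add_lt_add_iff_left σ).2 (naturalSum_lt_opow hτ hα)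
    -- A supremum of values below `σ + ρ` might reach it; the outer induction hypothesis at `δ`
    -- replaces it by one earlier value plus an ordinary sum below `ρ`.
    · obtain ⟨δ₀, hδ₀, H⟩ := ih δ h' hδ
      have hm : max δ₀ δ₁ < δ := max_lt hδ₀ h1
      obtain ⟨τ, hτ, hSδ⟩ := hsplit _ (le_max_right δ₀ δ₁)
        (IH _ hm (le_max_right _ _) (hm.trans h'))
      refine (H _ (le_max_left δ₀ δ₁) hm).trans_lt ?_
      rw [hSδ, add_assoc]
      exact (add_lt_add_iff_left σ).2
        (hprin (hθ ▸ hτ) (hsub _ _ (le_max_right _ _) hm.le h'))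
  refine (isLUB_iteratedNaturalSum_limit α hζ).2 ?_
  rintro _ ⟨δ, hδ, rfl⟩
  have hσρ : σ + ρ ≤ S δ₁ + ρ := add_le_add_left (hσS δ₁ le_rfl) ρ
  rcases le_total δ δ₁ with h | h
  · exact (iteratedNaturalSum_mono α h).trans le_self_add
  · exact (key δ h hδ).le.trans hσρ

/-! ### Realizing a natural sum with finitely many cuts -/

/-- `X` and `Y` realize `o` as a mixed sum of `a` and `b`, and there are finitely many ordinals such
that whenever an element of `X` lies below an element of `Y`, one of them separates the two. -/
def RealizesWithFiniteCuts (o a b : Ordinal.{u}) (X Y : Set Ordinal.{u}) : Prop :=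
  Disjoint X Y ∧ X ∪ Y = Iio o ∧ HasOrderType X a ∧ HasOrderType Y b ∧
    ∃ F : Set Ordinal.{u}, F.Finite ∧ ∀ x ∈ X, ∀ y ∈ Y, x < y → ∃ c ∈ F, x < c ∧ c ≤ y

theorem image_add_left_subset_Ici (c : Ordinal.{u}) (X : Set Ordinal.{u}) :
    (c + ·) '' X ⊆ Ici c := by
  rintro _ ⟨x, -, rfl⟩
  exact (le_self_add : c ≤ c + x)

/-- An `a'`-block and then a `b'`-block go in front of the shifted realization. The point `a'`
separates the new block of the first set from all of the second; pairs beyond both blocks use the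
shifted old cuts. -/
theorem RealizesWithFiniteCuts.prepend {o a b a' b' : Ordinal.{u}} {X Y : Set Ordinal.{u}}
    (h : RealizesWithFiniteCuts o a b X Y) :
    RealizesWithFiniteCuts (a' + b' + o) (a' + a) (b' + b)
      (Iio a' ∪ (a' + b' + ·) '' X) (Ico a' (a' + b') ∪ (a' + b' + ·) '' Y) := by
  obtain ⟨hd, hu, hX, hY, F, hF, hcut⟩ := h
  set c := a' + b' with hc
  have hac : a' ≤ c := le_self_add
  have hX' := image_add_left_subset_Ici c X
  have hY' := image_add_left_subset_Ici c Y
  refine ⟨?_, ?_, ?_, ?_, insert a' (insert c ((c + ·) '' F)), ((hF.image _).insert _).insert _, ?_⟩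
  · rw [Set.disjoint_left]
    rintro x (hx | hx) (hy | hy)
    · exact hx.not_ge hy.1
    · exact (hx.trans_le hac).not_ge (hY' hy)
    · exact hy.2.not_ge (hX' hx)
    · obtain ⟨x, hx, rfl⟩ := hx
      obtain ⟨y, hy, hxy⟩ := hy
      exact Set.disjoint_left.1 hd hx ((strictMono_add_left c).injective hxy ▸ hy)
  · rw [union_union_union_comm, ← image_union, hu, image_add_left_Iio, Iio_union_Ico_eq_Iio hac,
      Iio_union_Ico_eq_Iio le_self_add]
  · refine (hasOrderType_Iio a').union (hX.image ((strictMono_add_left c).strictMonoOn _)) ?_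
    exact fun x hx y hy => (mem_Iio.1 hx).trans_le (hac.trans (hX' hy))
  · refine (hasOrderType_Ico_add a' b').union (hY.image ((strictMono_add_left c).strictMonoOn _)) ?_
    exact fun x hx y hy => hx.2.trans_le (hY' hy)
  · rintro x (hx | hx) y (hy | hy) hxy
    · exact ⟨a', by simp, hx, hy.1⟩
    · exact ⟨a', by simp, hx, hac.trans (hY' hy)⟩
    · exact absurd (hxy.trans hy.2) (hX' hx).not_gt
    · obtain ⟨x, hx, rfl⟩ := hx
      obtain ⟨y, hy, rfl⟩ := hy
      obtain ⟨d, hd, h1, h2⟩ := hcut x hx y hy (by simpa using hxy)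
      exact ⟨c + d, by simp [hd], by simpa using h1, by simpa using h2⟩

/-- The leading blocks `ω ^ e * n` and `ω ^ e * m` are put in front and the remainders merged by
induction on the exponent. -/
theorem exists_realizesWithFiniteCuts (a b : Ordinal.{u}) :
    ∃ X Y, RealizesWithFiniteCuts (naturalSum a b) a b X Y := by
  obtain ⟨e, ha, hb⟩ := exists_lt_omega0_opow a b
  induction e using Ordinal.limitRecOn generalizing a b with
  | zero =>
    simp only [opow_zero, Order.lt_one_iff] at ha hb
    subst ha hb
    refine ⟨∅, ∅, disjoint_bot_left, ?_, ?_, ?_, ∅, finite_empty, by simp⟩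
    · simp [naturalSum_zero_right]
    · simpa using hasOrderType_Iio (0 : Ordinal.{u})
    · simpa using hasOrderType_Iio (0 : Ordinal.{u})
  | add_one e ih =>
    obtain ⟨n, hn, r, hr, rfl⟩ := eq_opow_mul_add ha
    obtain ⟨m, hm, s, hs, rfl⟩ := eq_opow_mul_add hb
    obtain ⟨X, Y, h⟩ := ih r s hr hs
    rw [naturalSum_opow_mul_add hn hm hr hs, mul_add]
    exact ⟨_, _, h.prepend⟩
  | limit e he ih =>
    obtain ⟨e', he', h⟩ := (lt_opow_of_isSuccLimit omega0_ne_zero he).1 (max_lt ha hb)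
    exact ih e' he' a b (max_lt_iff.1 h).1 (max_lt_iff.1 h).2

/-! ### Realizing the iterated natural sum -/

/-- A realization of `β` as a mixed sum of `α γ` for `γ < ζ`, with finite overlaps and almost all
pieces convex, the family of pieces being indexed by all ordinals. -/
structure GoodRealization (ζ : Ordinal.{u}) (α : Ordinal.{u} → Ordinal.{u}) (β : Ordinal.{u})
    (A : Ordinal.{u} → Set Ordinal.{u}) : Prop where
  disjoint : ∀ i < ζ, ∀ j < ζ, i ≠ j → Disjoint (A i) (A j)
  subset : ∀ i < ζ, A i ⊆ Iio β
  cover : ∀ x < β, ∃ i < ζ, x ∈ A i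
  orderType : ∀ i < ζ, HasOrderType (A i) (α i)
  finiteOverlap : ∀ ε < ζ, {γ | γ < ζ ∧ ε < γ ∧ ∃ b ∈ A γ, ∃ a ∈ A ε, b < a}.Finite
  convex : {ε | ε < ζ ∧ ¬ IsConvexPiece β (A ε)}.Finite

theorem GoodRealization.le {ζ β : Ordinal.{u}} {α : Ordinal.{u} → Ordinal.{u}}
    {A : Ordinal.{u} → Set Ordinal.{u}} (h : GoodRealization ζ α β A) :
    β ≤ iteratedNaturalSum α ζ := by
  refine le_of_orderTypeLE_Iio ((orderTypeLE_iteratedNaturalSum α A ζ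
    (fun γ hγ => (h.orderType γ hγ).orderTypeLE) fun ε hε a ha =>
      (h.finiteOverlap ε hε).subset ?_).mono fun x hx => ?_)
  · rintro γ ⟨hγ, hεγ, b, hb, hba⟩
    exact ⟨hγ, hεγ, b, hb, a, ha, hba⟩
  · obtain ⟨i, hi, hx⟩ := h.cover x hx
    exact mem_iUnion₂.2 ⟨i, hi, hx⟩

/-- The old pieces are transported along the enumeration `f` of `X`, and `Y` becomes the piece of
index `δ`, so each overlap set gains at most `δ`. -/
theorem GoodRealization.exists_add_one {δ β : Ordinal.{u}} {α : Ordinal.{u} → Ordinal.{u}}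
    {A : Ordinal.{u} → Set Ordinal.{u}} (h : GoodRealization δ α β A) :
    ∃ A', GoodRealization (δ + 1) α (naturalSum β (α δ)) A' := by
  obtain ⟨X, Y, hd, hu, hX, hY, F, hF, hcut⟩ := exists_realizesWithFiniteCuts β (α δ)
  obtain ⟨f, hf, rfl⟩ := hasOrderType_iff.1 hX
  have hfX : ∀ i < δ, f '' A i ⊆ f '' Iio β := fun i hi => image_mono (h.subset i hi)
  have hdisj : ∀ i < δ, ∀ j < δ, i ≠ j → Disjoint (f '' A i) (f '' A j) := by
    intro i hi j hj hij
    rw [Set.disjoint_left]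
    rintro _ ⟨x, hx, rfl⟩ ⟨y, hy, hxy⟩
    have := hf.injOn (h.subset j hj hy) (h.subset i hi hx) hxy
    exact Set.disjoint_left.1 (h.disjoint i hi j hj hij) hx (this ▸ hy)
  have hlt : ∀ {i}, i < δ + 1 → i ≠ δ → i < δ := fun hi h' =>
    lt_of_le_of_ne (Order.lt_add_one_iff.1 hi) h'
  refine ⟨fun i => if i = δ then Y else f '' A i, ⟨?_, ?_, ?_, ?_, ?_, ?_⟩⟩
  · intro i hi j hj hij
    split_ifs with h1 h2 h2
    · exact absurd (h1.trans h2.symm) hij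
    · exact (hd.mono_left (hfX j (hlt hj h2))).symm
    · exact hd.mono_left (hfX i (hlt hi h1))
    · exact hdisj i (hlt hi h1) j (hlt hj h2) hij
  · intro i hi
    rw [← hu]
    split_ifs with h1
    · exact subset_union_right
    · exact (hfX i (hlt hi h1)).trans subset_union_left
  · intro x hx
    rw [← mem_Iio, ← hu] at hx
    rcases hx with ⟨x, hx, rfl⟩ | hx
    · obtain ⟨i, hi, hx⟩ := h.cover x hx
      refine ⟨i, hi.trans (lt_add_one δ), ?_⟩
      rw [if_neg hi.ne]
      exact mem_image_of_mem f hx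
    · exact ⟨δ, lt_add_one δ, by rwa [if_pos rfl]⟩
  · intro i hi
    split_ifs with h1
    · rwa [h1]
    · exact (h.orderType i (hlt hi h1)).image (hf.mono (h.subset i (hlt hi h1)))
  · intro ε hε
    rcases (Order.lt_add_one_iff.1 hε).eq_or_lt with rfl | hε
    · refine Set.finite_empty.subset ?_
      rintro γ ⟨hγ, hεγ, -⟩
      exact (Order.lt_add_one_iff.1 hγ).not_gt hεγ
    · refine ((h.finiteOverlap ε hε).insert δ).subset ?_
      rintro γ ⟨hγ, hεγ, b, hb, a, ha, hba⟩
      rcases eq_or_ne γ δ with rfl | hne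
      · exact mem_insert _ _
      · rw [if_neg hne] at hb
        rw [if_neg hε.ne] at ha
        obtain ⟨b, hb, rfl⟩ := hb
        obtain ⟨a, ha, rfl⟩ := ha
        have hγ := hlt hγ hne
        exact Or.inr ⟨hγ, hεγ, b, hb, a, ha,
          (hf.lt_iff_lt (h.subset γ hγ hb) (h.subset ε hε ha)).1 hba⟩
  -- `B c` collects the formerly convex pieces straddling the cut `c`. Two disjoint ones cannot both
  -- do so: the one whose point below `c` is smaller would contain the other's point.
  · let B : Ordinal.{u} → Set Ordinal.{u} := fun c =>
      {ε | ε < δ ∧ IsConvexPiece β (A ε) ∧ ∃ x ∈ f '' A ε, ∃ y ∈ f '' A ε, x < c ∧ c ≤ y}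
    have hBlt : ∀ c, ∀ i ∈ B c, ∀ j ∈ B c, i ≠ j → ∀ x ∈ f '' A i, ∀ x' ∈ f '' A i,
        ∀ y ∈ f '' A j, y < c → c ≤ x' → ¬ x ≤ y := by
      intro c i hi j hj hij x hx x' hx' y hy hyc hcx' hxy
      suffices y ∈ f '' A i from Set.disjoint_left.1 (hdisj i hi.1 j hj.1 hij) this hy
      rcases hxy.eq_or_lt with rfl | hxy
      · exact hx
      have hyx' := hyc.trans_le hcx'
      obtain ⟨x, hx, rfl⟩ := hx
      obtain ⟨x', hx', rfl⟩ := hx'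
      obtain ⟨y, hy, rfl⟩ := hy
      have h1 := h.subset i hi.1 hx
      have h2 := h.subset i hi.1 hx'
      have h3 := h.subset j hj.1 hy
      rw [hf.lt_iff_lt h1 h3] at hxy
      rw [hf.lt_iff_lt h3 h2] at hyx'
      exact mem_image_of_mem f (hi.2.1 x hx x' hx' (hxy.trans hyx') ⟨h3, hxy, hyx'⟩)
    have hB : ∀ c, (B c).Subsingleton := by
      intro c i hi j hj
      by_contra hij
      obtain ⟨x, hx, x', hx', h1, h2⟩ := hi.2.2
      obtain ⟨y, hy, y', hy', h3, h4⟩ := hj.2.2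
      rcases le_total x y with h' | h'
      · exact hBlt c i hi j hj hij x hx x' hx' y hy h3 h2 h'
      · exact hBlt c j hj i hi (Ne.symm hij) y hy y' hy' x hx h1 h4 h'
    refine ((h.convex.union (hF.biUnion fun c _ => (hB c).finite)).insert δ).subset ?_
    rintro ε ⟨hε, hconv⟩
    rcases eq_or_ne ε δ with rfl | hne
    · exact mem_insert _ _
    have hε := hlt hε hne
    rw [if_neg hne] at hconv
    by_cases hc : IsConvexPiece β (A ε)
    swap
    · exact Or.inr (Or.inl ⟨hε, hc⟩)
    simp only [IsConvexPiece, not_forall, not_subset, exists_prop] at hconv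
    obtain ⟨x, hx, x', hx', hxx', y, ⟨hy, hxy, hyx'⟩, hyA⟩ := hconv
    rw [← mem_Iio, ← hu] at hy
    -- An intruder from `X` contradicts the old convexity; one from `Y` yields a cut inside the
    -- piece.
    rcases hy with hy | hy
    · exfalso
      obtain ⟨x, hx, rfl⟩ := hx
      obtain ⟨x', hx', rfl⟩ := hx'
      obtain ⟨y, hy, rfl⟩ := hy
      have h1 := h.subset ε hε hx
      have h2 := h.subset ε hε hx'
      rw [hf.lt_iff_lt h1 hy] at hxy
      rw [hf.lt_iff_lt hy h2] at hyx'
      exact hyA (mem_image_of_mem f (hc x hx x' hx' (hxy.trans hyx') ⟨hy, hxy, hyx'⟩))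
    · obtain ⟨c, hcF, h1, h2⟩ := hcut x (hfX ε hε hx) y hy hxy
      exact Or.inr (Or.inr (mem_iUnion₂.2
        ⟨c, hcF, hε, hc, x, hx, x', hx', h1, h2.trans hyx'.le⟩))

theorem GoodRealization.exists_add_tail {δ₀ ζ β : Ordinal.{u}} {α : Ordinal.{u} → Ordinal.{u}}
    {A : Ordinal.{u} → Set Ordinal.{u}} (h : GoodRealization δ₀ α β A) (hζ : δ₀ ≤ ζ) :
    ∃ A', GoodRealization ζ α (β + (ordinalSum α ζ - ordinalSum α δ₀)) A' := by
  -- `Q γ` is the left endpoint of the interval given to the index `γ ≥ δ₀`.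
  set Q : Ordinal.{u} → Ordinal.{u} := fun δ => β + (ordinalSum α δ - ordinalSum α δ₀) with hQ
  have hQ0 : Q δ₀ = β := by simp [hQ]
  have hQmono : Monotone Q := fun a b hab =>
    add_le_add_right (sub_le_sub_right' (ordinalSum_mono α hab) _) β
  have hQsucc : ∀ γ, δ₀ ≤ γ → Q (γ + 1) = Q γ + α γ := fun γ hγ => by
    simp only [hQ]
    rw [ordinalSum_sub_add_one α hγ, add_assoc]
  have hβQ : ∀ γ, β ≤ Q γ := fun γ => le_self_add
  have hcover : ∀ δ, δ₀ ≤ δ → ∀ x, β ≤ x → x < Q δ →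
      ∃ γ < δ, δ₀ ≤ γ ∧ x ∈ Ico (Q γ) (Q (γ + 1)) := by
    intro δ
    induction δ using WellFoundedLT.induction with
    | ind δ ih =>
    intro hδ x hβx hx
    rcases hδ.eq_or_lt with rfl | hδ
    · exact absurd (hQ0 ▸ hx) hβx.not_gt
    -- Either `x` is already below an earlier endpoint, as always happens at limits, or it lies in
    -- the last interval.
    obtain ⟨δ', hδ', hle, hx'⟩ | ⟨γ, rfl, hγ⟩ :
        (∃ δ' < δ, δ₀ ≤ δ' ∧ x < Q δ') ∨ ∃ γ, δ = γ + 1 ∧ Q γ ≤ x := by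
      rcases zero_or_succ_or_isSuccLimit δ with rfl | ⟨γ, rfl⟩ | hlim
      · simp at hδ
      · rw [Order.succ_eq_add_one] at *
        rcases lt_or_ge x (Q γ) with h' | h'
        · exact Or.inl ⟨γ, lt_add_one γ, Order.lt_add_one_iff.1 hδ, h'⟩
        · exact Or.inr ⟨γ, rfl, h'⟩
      · left
        rw [← Ordinal.add_sub_cancel_of_le hβx] at hx ⊢
        rw [hQ, add_lt_add_iff_left, Ordinal.lt_sub, lt_ordinalSum_limit α hlim] at hx
        obtain ⟨δ', hδ', hx⟩ := hx
        refine ⟨max δ' δ₀, max_lt hδ' hδ, le_max_right _ _, ?_⟩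
        rw [hQ, add_lt_add_iff_left, Ordinal.lt_sub]
        exact hx.trans_le (ordinalSum_mono α (le_max_left _ _))
    · obtain ⟨γ, hγ, h'⟩ := ih δ' hδ' hle x hβx hx'
      exact ⟨γ, hγ.trans hδ', h'⟩
    · exact ⟨γ, lt_add_one γ, Order.lt_add_one_iff.1 hδ, hγ, hx⟩
  have hbelow : ∀ {i j}, i < δ₀ → ∀ {x y}, x ∈ A i → y ∈ Ico (Q j) (Q (j + 1)) → x < y :=
    fun hi _ _ hx hy => lt_of_lt_of_le (h.subset _ hi hx) ((hβQ _).trans hy.1)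
  have hIco : ∀ {i j}, i < j → ∀ {x y}, x ∈ Ico (Q i) (Q (i + 1)) → y ∈ Ico (Q j) (Q (j + 1)) →
      x < y :=
    fun hij _ _ hx hy => hx.2.trans_le ((hQmono (Order.add_one_le_of_lt hij)).trans hy.1)
  refine ⟨fun i => if i < δ₀ then A i else Ico (Q i) (Q (i + 1)), ⟨?_, ?_, ?_, ?_, ?_, ?_⟩⟩
  · intro i hi j hj hij
    split_ifs with h1 h2 h2
    · exact h.disjoint i h1 j h2 hij
    · exact Set.disjoint_left.2 fun x hx hy => (hbelow h1 hx hy).false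
    · exact Set.disjoint_left.2 fun x hx hy => (hbelow h2 hy hx).false
    · rcases lt_or_gt_of_ne hij with hij | hij
      · exact Set.disjoint_left.2 fun x hx hy => (hIco hij hx hy).false
      · exact Set.disjoint_left.2 fun x hx hy => (hIco hij hy hx).false
  · intro i hi
    split_ifs with h1
    · exact (h.subset i h1).trans (Iio_subset_Iio (hβQ ζ))
    · exact fun x hx => hx.2.trans_le (hQmono (Order.add_one_le_of_lt hi))
  · intro x hx
    rcases lt_or_ge x β with h' | h'
    · obtain ⟨i, hi, hx⟩ := h.cover x h'
      exact ⟨i, hi.trans_le hζ, by rwa [if_pos hi]⟩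
    · obtain ⟨γ, hγ, hle, hx⟩ := hcover ζ hζ x h' hx
      exact ⟨γ, hγ, by rwa [if_neg hle.not_gt]⟩
  · intro i hi
    split_ifs with h1
    · exact h.orderType i h1
    · rw [hQsucc i (not_lt.1 h1)]
      exact hasOrderType_Ico_add _ _
  · intro ε hε
    by_cases h1 : ε < δ₀
    · refine (h.finiteOverlap ε h1).subset ?_
      rintro γ ⟨hγ, hεγ, b, hb, a, ha, hba⟩
      rw [if_pos h1] at ha
      by_cases h2 : γ < δ₀
      · rw [if_pos h2] at hb
        exact ⟨h2, hεγ, b, hb, a, ha, hba⟩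
      · rw [if_neg h2] at hb
        exact absurd (hbelow h1 ha hb) hba.asymm
    · refine Set.finite_empty.subset ?_
      rintro γ ⟨hγ, hεγ, b, hb, a, ha, hba⟩
      rw [if_neg h1] at ha
      rw [if_neg fun h2 => h1 (hεγ.trans h2)] at hb
      exact (hIco hεγ ha hb).asymm hba
  · refine h.convex.subset ?_
    rintro ε ⟨hε, hconv⟩
    by_cases h1 : ε < δ₀
    · rw [if_pos h1] at hconv
      refine ⟨h1, fun hc => hconv fun a ha a' ha' haa' => ?_⟩
      rintro b ⟨-, hab, hba'⟩
      exact hc a ha a' ha' haa' ⟨hba'.trans (h.subset ε h1 ha'), hab, hba'⟩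
    · rw [if_neg h1] at hconv
      refine absurd (fun a ha a' ha' _ => ?_) hconv
      rintro b ⟨-, hab, hba'⟩
      exact ⟨ha.1.trans hab.le, hba'.trans ha'.2⟩

theorem exists_goodRealization (α : Ordinal.{u} → Ordinal.{u}) (ζ : Ordinal.{u}) :
    ∃ A, GoodRealization ζ α (iteratedNaturalSum α ζ) A := by
  induction ζ using Ordinal.limitRecOn with
  | zero =>
    rw [iteratedNaturalSum_zero]
    refine ⟨fun _ => ∅, ⟨?_, ?_, ?_, ?_, ?_, ?_⟩⟩ <;> simp
  | add_one ζ ih =>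
    obtain ⟨A, h⟩ := ih
    rw [iteratedNaturalSum_add_one]
    exact h.exists_add_one
  | limit ζ hζ ih =>
    obtain ⟨δ₀, hδ₀, hle⟩ := exists_forall_iteratedNaturalSum_le α hζ
    obtain ⟨A, h⟩ := ih δ₀ hδ₀
    obtain ⟨A', h'⟩ := h.exists_add_tail hδ₀.le
    -- The realized ordinal is at least the iterated sum by choice of `δ₀`, and at most that by the
    -- upper bound.
    rw [← h'.le.antisymm (hle δ₀ le_rfl hδ₀)] at *
    exact ⟨A', h'⟩

/-! ### Families indexed by an initial segment -/

theorem GoodRealization.realizes {ζ β : Ordinal.{u}} {α : Ordinal.{u} → Ordinal.{u}}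
    {A : Ordinal.{u} → Set Ordinal.{u}} (h : GoodRealization ζ α β A) :
    Realizes β (fun γ : Iio ζ => α γ.1) fun γ : Iio ζ => A γ.1 where
  pairwise_disjoint i j hij := h.disjoint i i.2 j j.2 (Subtype.coe_injective.ne hij)
  iUnion_eq := by
    refine subset_antisymm (iUnion_subset fun i => h.subset i i.2) fun x hx => ?_
    obtain ⟨i, hi, hx⟩ := h.cover x hx
    exact mem_iUnion.2 ⟨⟨i, hi⟩, hx⟩
  orderType i := h.orderType i i.2

theorem GoodRealization.finiteOverlap_Iio {ζ β : Ordinal.{u}} {α : Ordinal.{u} → Ordinal.{u}}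
    {A : Ordinal.{u} → Set Ordinal.{u}} (h : GoodRealization ζ α β A) :
    FiniteOverlap fun γ : Iio ζ => A γ.1 := fun ε =>
  ((h.finiteOverlap ε ε.2).preimage Subtype.coe_injective.injOn).subset
    fun γ hγ => ⟨γ.2, hγ.1, hγ.2⟩

theorem GoodRealization.almostAllConvex {ζ β : Ordinal.{u}} {α : Ordinal.{u} → Ordinal.{u}}
    {A : Ordinal.{u} → Set Ordinal.{u}} (h : GoodRealization ζ α β A) :
    AlmostAllConvex β fun γ : Iio ζ => A γ.1 :=
  (h.convex.preimage Subtype.coe_injective.injOn).subset fun γ hγ => ⟨γ.2, hγ⟩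

theorem FiniteOverlap.pointwiseFinite {ζ : Ordinal.{u}} {A : Iio ζ → Set Ordinal.{u}}
    (h : FiniteOverlap A) : PointwiseFinite A := by
  intro ε a ha
  refine (h ε).subset ?_
  rintro γ ⟨hεγ, b, hb, hba⟩
  exact ⟨hεγ, b, hb, a, ha, hba⟩

theorem Realizes.le_iteratedNaturalSum {ζ β : Ordinal.{u}} {α : Ordinal.{u} → Ordinal.{u}}
    {A : Iio ζ → Set Ordinal.{u}} (h : Realizes β (fun γ : Iio ζ => α γ.1) A)
    (hA : PointwiseFinite A) : β ≤ iteratedNaturalSum α ζ := by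
  -- Extending by empty pieces makes the bound for families indexed by all ordinals applicable.
  let A' : Ordinal.{u} → Set Ordinal.{u} := fun γ => if hγ : γ < ζ then A ⟨γ, hγ⟩ else ∅
  have hA' : ∀ γ (hγ : γ < ζ), A' γ = A ⟨γ, hγ⟩ := fun γ hγ => dif_pos hγ
  refine le_of_orderTypeLE_Iio ((orderTypeLE_iteratedNaturalSum α A' ζ (fun γ hγ => ?_)
    fun ε hε a ha => ?_).mono fun x hx => ?_)
  · rw [hA' γ hγ]
    exact (h.orderType ⟨γ, hγ⟩).orderTypeLE
  · rw [hA' ε hε] at ha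
    refine ((hA ⟨ε, hε⟩ a ha).image Subtype.val).subset ?_
    rintro γ ⟨hγ, hεγ, b, hb, hba⟩
    rw [hA' γ hγ] at hb
    exact ⟨⟨γ, hγ⟩, ⟨hεγ, b, hb, hba⟩, rfl⟩
  · rw [← h.iUnion_eq] at hx
    obtain ⟨⟨γ, hγ⟩, hx⟩ := mem_iUnion.1 hx
    exact mem_iUnion₂.2 ⟨γ, hγ, by rwa [hA' γ hγ]⟩

end MixedSums

theorem corollary4p3 (ζ : Ordinal.{u}) (α : Ordinal.{u} → Ordinal.{u}) :
    -- the iterated natural sum is a mixed sum, with a realization having finite overlaps and almost all pieces convex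
    MixedSums.IsMixedSum (MixedSums.iteratedNaturalSum α ζ) (fun γ : Set.Iio ζ => α γ.1) ∧
    (∃ A : Set.Iio ζ → Set Ordinal.{u},
      MixedSums.Realizes (MixedSums.iteratedNaturalSum α ζ) (fun γ : Set.Iio ζ => α γ.1) A ∧
      MixedSums.FiniteOverlap A ∧
      MixedSums.AlmostAllConvex (MixedSums.iteratedNaturalSum α ζ) A) ∧
    -- the pointwise finiteness condition is weaker than the finite overlap condition
    (∀ (β : Ordinal.{u}) (A : Set.Iio ζ → Set Ordinal.{u}),
      MixedSums.Realizes β (fun γ : Set.Iio ζ => α γ.1) A →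
      MixedSums.FiniteOverlap A → MixedSums.PointwiseFinite A) ∧
    -- it is the largest mixed sum with a pointwise finite realization
    IsGreatest {β : Ordinal.{u} | ∃ A : Set.Iio ζ → Set Ordinal.{u},
        MixedSums.Realizes β (fun γ : Set.Iio ζ => α γ.1) A ∧ MixedSums.PointwiseFinite A}
      (MixedSums.iteratedNaturalSum α ζ) ∧
    -- it is the largest mixed sum with a realization having finite overlaps and almost all pieces convex
    IsGreatest {β : Ordinal.{u} | ∃ A : Set.Iio ζ → Set Ordinal.{u},
        MixedSums.Realizes β (fun γ : Set.Iio ζ => α γ.1) A ∧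
        MixedSums.FiniteOverlap A ∧ MixedSums.AlmostAllConvex β A}
      (MixedSums.iteratedNaturalSum α ζ) := by
  obtain ⟨A, hA⟩ := MixedSums.exists_goodRealization α ζ
  refine ⟨⟨_, hA.realizes⟩, ⟨_, hA.realizes, hA.finiteOverlap_Iio, hA.almostAllConvex⟩,
    fun _ _ _ h => h.pointwiseFinite, ⟨⟨_, hA.realizes, hA.finiteOverlap_Iio.pointwiseFinite⟩, ?_⟩,
    ⟨_, hA.realizes, hA.finiteOverlap_Iio, hA.almostAllConvex⟩, ?_⟩
  · rintro β ⟨B, hB, hfin⟩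
    exact hB.le_iteratedNaturalSum hfin
  · rintro β ⟨B, hB, hfin, -⟩
    exact hB.le_iteratedNaturalSum hfin.pointwiseFinite
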